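/- Let $M$ be a collectible reward decomposition MDP with $n\ge 2$ rewards: a deterministic transition system in which each step takes one unit of time, with an initial state $s_0$ and $n$ distinct reward states $s_1,\dots,s_n$. The reward at $s_i$ has value $1$ and can be collected only once. Let $d(u,v)$ be the length of a shortest path from $u$ to $v$. Assume that every $s_j$ can be reached from $s_0$ and from every $s_i$, and that $d(s_i,s_j)=d(s_j,s_i)$ for all $i,j\ge 1$. For a discount factor $\gamma\in[0,1]$ (with $0^0=1$), the return of the tour that collects the rewards in the order $i_1,\dots,i_n$ is $$\sum_{j=0}^{n-1}\gamma^{\sum_{t=0}^{j} d(s_{i_t},s_{i_{t+1}})},\qquad i_0=0,$$ and $\mathrm{OPT}$ is the maximum of the return over all permutations $(i_1,\dots,i_n)$ of $\{1,\dots,n\}$. The policy NN starts at $s_0$ and always goes next to an uncollected reward nearest to its current position. The policy RA first goes from $s_0$ to a uniformly random reward $s_i$, and then collects the remaining rewards in increasing order of their distance from $s_i$. The policy NN-RA runs NN with probability $1/2$ and RA with probability $1/2$. Ties are broken arbitrarily. Write $\text{NN-RA}$ also for its expected return. **Theorem (NN-RA performance).** 1. For every $\alpha>0$ there is a constant $c>0$,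 depending only on $\alpha$, such that for all $n\ge2$, all such $M$, all $\gamma\in[0,1]$ and all ways of breaking ties, if $\mathrm{OPT}\ge\alpha n$ then $$\text{NN-RA}\;\ge\; c\,\frac{n^{-2/3}}{\log n}\,\mathrm{OPT}.$$ 2. There is an absolute constant $c>0$ such that for all $n\ge2$, all such $M$, all $\gamma\in[0,1]$ and all ways of breaking ties, $$\text{NN-RA}\;\ge\; c\,\frac{n^{-3/4}}{\log n}\,\mathrm{OPT}.$$ -/

import Mathlib

/-- A collectible reward decomposition MDP with `n` rewards: deterministic dynamics `step`,
initial state `start`, and `n` distinct reward states. Reward `i` equals `1` at the state `goal i`,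
equals `0` at every other state, and can be collected only once; the reward of the MDP is the sum
of these `n` rewards. -/
structure CollectibleMDP (n : ℕ) where
  /-- the states -/
  State : Type*
  /-- the primitive actions -/
  Action : Type*
  /-- the deterministic dynamics -/
  step : State → Action → State
  /-- the initial state `s₀` -/
  start : State
  /-- the states `s₁, …, sₙ` that carry the rewards -/
  goal : Fin n → State
  goal_injective : Function.Injective goal

namespace CollectibleMDP

variable {n : ℕ} (M : CollectibleMDP n)

/-- The action sequence `l`, executed from state `u`, ends in state `v`. -/
def Leads (u : M.State) (l : List M.Action) (v : M.State) : Prop :=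
  l.foldl M.step u = v

/-- The length of a shortest path from `u` to `v` (only used when there is a path). -/
noncomputable def dist (u v : M.State) : ℕ :=
  sInf {k : ℕ | ∃ l : List M.Action, l.length = k ∧ M.Leads u l v}

/-- There is an option for collecting each reward: every reward state can be reached from the
initial state and from every reward state. -/
def HasOptions : Prop :=
  (∀ j, ∃ l, M.Leads M.start l (M.goal j)) ∧ ∀ i j, ∃ l, M.Leads (M.goal i) l (M.goal j)

/-- The distances between rewards are symmetric. -/
def IsUndirected : Prop :=
  ∀ i j, M.dist (M.goal i) (M.goal j) = M.dist (M.goal j) (M.goal i)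

/-- The stops of the tour that collects the rewards in the order `σ 0, σ 1, …`: stop `0` is the
initial state, and stop `j + 1` is the state of the reward `σ j`. -/
def route (σ : Equiv.Perm (Fin n)) : Fin (n + 1) → M.State :=
  Fin.cons M.start fun j => M.goal (σ j)

/-- The time at which the tour `σ` collects the reward `σ j`. -/
noncomputable def arrival (σ : Equiv.Perm (Fin n)) (j : Fin n) : ℕ :=
  ∑ t ∈ Finset.Iic j, M.dist (M.route σ t.castSucc) (M.route σ t.succ)

/-- The discounted return of the tour `σ`. -/
noncomputable def tourReturn (γ : ℝ) (σ : Equiv.Perm (Fin n)) : ℝ :=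
  ∑ j : Fin n, γ ^ M.arrival σ j

/-- OPT: the largest discounted return of a tour. -/
noncomputable def opt (γ : ℝ) : ℝ :=
  Finset.univ.sup' Finset.univ_nonempty fun σ : Equiv.Perm (Fin n) => M.tourReturn γ σ

/-- `σ` is a run of NN from the initial state: the next reward is always one of the uncollected
rewards nearest to the current stop. (Ties are broken arbitrarily.) -/
def IsNNTour (σ : Equiv.Perm (Fin n)) : Prop :=
  ∀ j k : Fin n, j ≤ k →
    M.dist (M.route σ j.castSucc) (M.goal (σ j)) ≤ M.dist (M.route σ j.castSucc) (M.goal (σ k))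

/-- `σ` is a run of RA whose random first reward is `i`: it collects `i` first, and then the other
rewards in increasing order of their distance from `i`. (Ties are broken arbitrarily.) -/
def IsRATour (i : Fin n) (σ : Equiv.Perm (Fin n)) : Prop :=
  (∀ j : Fin n, (j : ℕ) = 0 → σ j = i) ∧
    Monotone fun j : Fin n => M.dist (M.goal i) (M.goal (σ j))

/-- The expected return of NN-RA when `nn` is the run of NN and `ra i` is the run of RA with first
reward `i`: with probability `1/2` the policy executes `nn`, and with probability `1/2` it executes
`ra i` for a uniformly random reward `i`. -/
noncomputable def nnraReturn (γ : ℝ) (nn : Equiv.Perm (Fin n))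
    (ra : Fin n → Equiv.Perm (Fin n)) : ℝ :=
  1 / 2 * M.tourReturn γ nn + 1 / 2 * ∑ i : Fin n, 1 / (n : ℝ) * M.tourReturn γ (ra i)

end CollectibleMDP

/-!
Write `a j` for the time at which a fixed tour collects its `j`-th reward, `j = 1, 2, …`.
The first step of NN already earns `γ ^ a 1`, so no term `γ ^ a j` exceeds the return `N` of NN.

For RA, consider `k` consecutive rewards of the tour, each followed by at least `q` more within a
stretch of duration `W`. On average the next `q` rewards lie within distance `q * W / k`, and a run
of RA that starts at a reward with `q` rewards within distance `r` collects all of them within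
additional time `2 * q * r`. With `q ≈ √k` the average delay is therefore `O(W)`, and by the AM-GM
inequality the runs of RA together earn about `k * √k` discounts. Taking the stretch that ends at
the `j` maximizing `j ^ (3 / 2) * γ ^ a j` and has length about `j / 2`, the loss `γ ^ O(W)` is
bounded below, whence `j ^ (3 / 2) * γ ^ a j = O(R)` for all `j`, where `R` is the sum of the `n`
possible returns of RA.

Using the first bound for `j ≤ n ^ (2 / 3)` and the second one for the convergent tail, the return
of the tour is `O(n ^ (2 / 3) * (N + R / n))`, even without the logarithm.
-/

theorem exists_add_add_eq_succ_and_sq_le (m : ℕ) :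
    ∃ h k q : ℕ, h + k + q = m + 1 ∧ 0 < k ∧ q ^ 2 ≤ k ∧ k ≤ (q + 1) ^ 2 ∧ m + 1 ≤ 4 * k ∧
      m + 1 ≤ 2 * (h + 1) := by
  set k := m / 4 + 1
  -- `q = ⌈√k⌉ - 1`, which unlike `⌊√k⌋` leaves room for the stretch when `m = 0`.
  set q := Nat.sqrt (k - 1)
  have hq_le : q ^ 2 ≤ k - 1 := Nat.sqrt_le' _
  have hq_lt : k - 1 < (q + 1) ^ 2 := Nat.lt_succ_sqrt' _
  have hqk : q ≤ k - 1 := Nat.sqrt_le_self _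
  exact ⟨m + 1 - k - q, k, q, by omega, by omega, by omega, by omega, by omega, by omega⟩

theorem card_mul_pow_le_sum_pow {ι : Type*} {s : Finset ι} {e : ι → ℕ} {E : ℕ} {x : ℝ}
    (hx : 0 ≤ x) (hx1 : x ≤ 1) (he : ∑ i ∈ s, e i ≤ s.card * E) :
    s.card * x ^ E ≤ ∑ i ∈ s, x ^ e i := by
  obtain rfl | hs := s.eq_empty_or_nonempty
  · simp
  have hcard : (0 : ℝ) < s.card := by exact_mod_cast hs.card_pos
  have am_gm := Real.geom_mean_le_arith_mean s (fun _ => 1) (fun i => x ^ e i)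
    (fun _ _ => zero_le_one) (by simpa using hcard) fun _ _ => pow_nonneg hx _
  simp only [Real.rpow_one, Finset.prod_pow_eq_pow_sum, Finset.sum_const, nsmul_eq_mul, mul_one,
    one_mul] at am_gm
  rw [mul_comm, ← le_div_iff₀ hcard]
  calc x ^ E = (x ^ (s.card * E)) ^ (s.card : ℝ)⁻¹ := by
        rw [mul_comm, pow_mul, Real.pow_rpow_inv_natCast (pow_nonneg hx _) hs.card_ne_zero]
    _ ≤ (x ^ ∑ i ∈ s, e i) ^ (s.card : ℝ)⁻¹ :=
        Real.rpow_le_rpow (pow_nonneg hx _) (pow_le_pow_of_le_one hx hx1 he) (by positivity)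
    _ ≤ _ := am_gm

theorem sum_range_sub_shift_le {a : ℕ → ℕ} (ha : Monotone a) (k q : ℕ) :
    ∑ t ∈ Finset.range k, (a (t + q) - a t) ≤ q * (a (k + q) - a 0) := by
  have hswap : ∑ t ∈ Finset.range k, (a (t + q) - a t) =
      ∑ t ∈ Finset.range q, (a (k + t) - a t) := by
    have hk := Finset.sum_range_add a k q
    have hq := Finset.sum_range_add a q k
    rw [add_comm q k] at hq
    simp only [add_comm q] at hq
    rw [Finset.sum_tsub_distrib _ fun t _ => ha (Nat.le_add_right t q),
      Finset.sum_tsub_distrib _ fun t _ => ha (Nat.le_add_left t k)]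
    omega
  calc ∑ t ∈ Finset.range k, (a (t + q) - a t)
      = ∑ t ∈ Finset.range q, (a (k + t) - a t) := hswap
    _ ≤ ∑ _t ∈ Finset.range q, (a (k + q) - a 0) :=
        Finset.sum_le_sum fun t ht => tsub_le_tsub
          (ha (Nat.add_le_add_left (Finset.mem_range.1 ht).le k)) (ha (Nat.zero_le t))
    _ = q * (a (k + q) - a 0) := by simp

theorem sum_range_add_mul_sub_shift_le {a : ℕ → ℕ} (ha : Monotone a) {k q W : ℕ}
    (hq : q ^ 2 ≤ k) (hW : ∀ t, a t ≤ a 0 + W) :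
    ∑ t ∈ Finset.range k, (a t + 2 * (a (t + q) - a t) * q) ≤ k * (a 0 + 3 * W) :=
  calc ∑ t ∈ Finset.range k, (a t + 2 * (a (t + q) - a t) * q)
      = ∑ t ∈ Finset.range k, a t + 2 * q * ∑ t ∈ Finset.range k, (a (t + q) - a t) := by
        rw [Finset.sum_add_distrib, Finset.mul_sum]
        congr! 2
        ring
    _ ≤ k * (a 0 + W) + 2 * q * (q * W) := by
        gcongr
        · simpa using Finset.sum_le_card_nsmul (Finset.range k) a _ fun t _ => hW t
        · refine (sum_range_sub_shift_le ha k q).trans (Nat.mul_le_mul_left q ?_)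
          exact tsub_le_iff_left.2 (hW _)
    _ = k * (a 0 + W) + q ^ 2 * (2 * W) := by ring
    _ ≤ k * (a 0 + W) + k * (2 * W) := by gcongr
    _ = k * (a 0 + 3 * W) := by ring

theorem sum_comp_le_sum_of_injOn {ι κ R : Type*} [Fintype κ] [AddCommMonoid R] [PartialOrder R]
    [IsOrderedAddMonoid R] {s : Finset ι} {c : ι → κ} {f : κ → R} (hc : Set.InjOn c s)
    (hf : ∀ j, 0 ≤ f j) : ∑ i ∈ s, f (c i) ≤ ∑ j, f j := by
  classical
  rw [← Finset.sum_image hc]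
  exact Finset.sum_le_univ_sum_of_nonneg hf

theorem pow_add_le_mul_pow_add_of_sq_le {x C : ℝ} (hx : 0 ≤ x) {b W : ℕ}
    (h : (x ^ b) ^ 2 ≤ C * (x ^ (b + W)) ^ 2) : x ^ (b + W) ≤ C * x ^ (b + 3 * W) := by
  have hW : 0 ≤ x ^ W := pow_nonneg hx W
  rw [pow_add, mul_pow, ← mul_assoc, mul_comm C, mul_assoc] at h
  rw [pow_add, pow_add, mul_comm 3 W, pow_mul]
  obtain hb | hb := (pow_nonneg hx b).eq_or_lt
  · simp [← hb]
  have hloss : 1 ≤ C * (x ^ W) ^ 2 := le_of_mul_le_mul_left (by simpa using h) (pow_pos hb 2)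
  calc x ^ b * x ^ W = x ^ b * x ^ W * 1 := (mul_one _).symm
    _ ≤ x ^ b * x ^ W * (C * (x ^ W) ^ 2) := by gcongr
    _ = C * (x ^ b * (x ^ W) ^ 3) := by ring

theorem inv_mul_sqrt_succ_le {x : ℝ} (hx : 0 < x) :
    ((x + 1) * √(x + 1))⁻¹ ≤ 2 / √x - 2 / √(x + 1) := by
  have hy : √(x + 1) ^ 2 = √x ^ 2 + 1 := by
    rw [Real.sq_sqrt hx.le, Real.sq_sqrt (by linarith)]
  have hu : 0 < √x := Real.sqrt_pos.2 hx
  have huv : √x ≤ √(x + 1) := Real.sqrt_le_sqrt (by linarith)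
  rw [← Real.sq_sqrt (by linarith : 0 ≤ x + 1), Real.sqrt_sq (Real.sqrt_nonneg _)]
  set u := √x
  set v := √(x + 1)
  have hv : 0 < v := hu.trans_le huv
  calc (v ^ 2 * v)⁻¹ = 2 / (v * v * (v + v)) := by field_simp; norm_num
    _ ≤ 2 / (u * v * (u + v)) := by gcongr
    _ = 2 * (v ^ 2 - u ^ 2) / (u * v * (u + v)) := by rw [hy]; ring
    _ = 2 / u - 2 / v := by field_simp; ring

theorem sum_Ico_inv_mul_sqrt_le {K : ℕ} (hK : 0 < K) (n : ℕ) :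
    ∑ j ∈ Finset.Ico K n, (((j : ℝ) + 1) * √(j + 1))⁻¹ ≤ 2 / √K := by
  obtain hn | hn := le_total n K
  · rw [Finset.Ico_eq_empty_of_le hn, Finset.sum_empty]
    positivity
  have telescope : ∑ j ∈ Finset.Ico K n, (((j : ℝ) + 1) * √(j + 1))⁻¹ ≤ 2 / √K - 2 / √n := by
    induction n, hn using Nat.le_induction with
    | base => simp
    | succ n hn ih =>
      rw [Finset.sum_Ico_succ_top hn]
      have hstep := inv_mul_sqrt_succ_le (x := n) (by exact_mod_cast hK.trans_le hn)
      push_cast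
      linarith
  exact telescope.trans (sub_le_self _ (by positivity))

theorem sum_le_mul_add_div_sqrt {n K : ℕ} {f : Fin n → ℝ} {A B : ℝ} (hA : 0 ≤ A) (hB : 0 ≤ B)
    (hK : 0 < K) (hfA : ∀ j, f j ≤ A) (hfB : ∀ j : Fin n, ((j : ℝ) + 1) * √(j + 1) * f j ≤ B) :
    ∑ j, f j ≤ K * A + 2 * B / √K := by
  set g : ℕ → ℝ := fun j => B * (((j : ℝ) + 1) * √(j + 1))⁻¹ with hg
  have hfg (j : Fin n) : f j ≤ g j := by
    simp only [hg, ← div_eq_mul_inv]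
    rw [le_div_iff₀' (by positivity)]
    exact hfB j
  calc ∑ j, f j ≤ ∑ j : Fin n, if (j : ℕ) < K then A else g j :=
        Finset.sum_le_sum fun j _ => by
          split_ifs
          exacts [hfA j, hfg j]
    _ = ∑ j ∈ Finset.range n, if j < K then A else g j :=
        Fin.sum_univ_eq_sum_range (fun j => if j < K then A else g j) n
    _ = ((Finset.range n).filter (· < K)).card * A +
          ∑ j ∈ Finset.range n with ¬ j < K, g j := by
        rw [Finset.sum_ite, Finset.sum_const, nsmul_eq_mul]
    _ ≤ K * A + ∑ j ∈ Finset.Ico K n, g j := by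
        gcongr
        · calc ((Finset.range n).filter (· < K)).card ≤ (Finset.range K).card :=
                Finset.card_le_card fun j hj =>
                  Finset.mem_range.2 (Finset.mem_filter.1 hj).2
            _ = K := Finset.card_range K
        · intro j hj
          simp only [Finset.mem_filter, Finset.mem_range, not_lt] at hj
          exact Finset.mem_Ico.2 ⟨hj.2, hj.1⟩
    _ ≤ K * A + B * (2 / √K) := by
        rw [hg, ← Finset.mul_sum]
        gcongr
        exact sum_Ico_inv_mul_sqrt_le hK n
    _ = K * A + 2 * B / √K := by ring

theorem sum_le_rpow_two_thirds_mul {n : ℕ} {f : Fin n → ℝ} {A B : ℝ} (hA : 0 ≤ A) (hB : 0 ≤ B)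
    (hfA : ∀ j, f j ≤ A) (hfB : ∀ j : Fin n, ((j : ℝ) + 1) * √(j + 1) * f j ≤ B) :
    ∑ j, f j ≤ 2 * (n : ℝ) ^ (2 / 3 : ℝ) * (A + B / n) := by
  obtain rfl | hn := n.eq_zero_or_pos
  · simp
  have hn1 : (1 : ℝ) ≤ n := by exact_mod_cast hn
  set y : ℝ := (n : ℝ) ^ (1 / 3 : ℝ) with hy
  have hy1 : 1 ≤ y := Real.one_le_rpow hn1 (by norm_num)
  have hy2 : (n : ℝ) ^ (2 / 3 : ℝ) = y ^ 2 := by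
    rw [hy, ← Real.rpow_mul_natCast (by positivity)]
    norm_num
  have hy3 : (n : ℝ) = y ^ 3 := by
    rw [hy, ← Real.rpow_mul_natCast (by positivity)]
    norm_num
  set K := ⌈y ^ 2⌉₊
  have hK_le : (K : ℝ) ≤ 2 * y ^ 2 := by
    have := Nat.ceil_lt_add_one (sq_nonneg y)
    nlinarith
  have hy_le : y ≤ √K := Real.le_sqrt_of_sq_le (Nat.le_ceil _)
  calc ∑ j, f j ≤ K * A + 2 * B / √K :=
        sum_le_mul_add_div_sqrt hA hB (Nat.ceil_pos.2 (by positivity)) hfA hfB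
    _ ≤ 2 * y ^ 2 * A + 2 * B / y := by gcongr
    _ = 2 * (n : ℝ) ^ (2 / 3 : ℝ) * (A + B / n) := by
        rw [hy2, hy3]
        field_simp

namespace CollectibleMDP

variable {n : ℕ} {M : CollectibleMDP n} {γ : ℝ}

section Distance

variable {u v w : M.State}

theorem dist_le_length {l : List M.Action} (h : M.Leads u l v) : M.dist u v ≤ l.length :=
  Nat.sInf_le ⟨l, rfl, h⟩

theorem exists_leads_length_eq_dist (h : ∃ l, M.Leads u l v) :
    ∃ l, l.length = M.dist u v ∧ M.Leads u l v := by
  obtain ⟨l, hl⟩ := h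
  exact Nat.sInf_mem (s := {k | ∃ l : List M.Action, l.length = k ∧ M.Leads u l v}) ⟨_, l, rfl, hl⟩

theorem Leads.append {l k : List M.Action} (huv : M.Leads u l v) (hvw : M.Leads v k w) :
    M.Leads u (l ++ k) w := by
  rw [Leads, List.foldl_append, huv, hvw]

variable (u) in
theorem dist_self : M.dist u u = 0 :=
  Nat.le_zero.1 (dist_le_length (l := []) rfl)

theorem dist_triangle (huv : ∃ l, M.Leads u l v) (hvw : ∃ l, M.Leads v l w) :
    M.dist u w ≤ M.dist u v + M.dist v w := by
  obtain ⟨l, hl, huv⟩ := exists_leads_length_eq_dist huv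
  obtain ⟨k, hk, hvw⟩ := exists_leads_length_eq_dist hvw
  rw [← hl, ← hk, ← List.length_append]
  exact dist_le_length (huv.append hvw)

end Distance

section Tour

variable (σ : Equiv.Perm (Fin n))

theorem arrival_zero (h : 0 < n) :
    M.arrival σ ⟨0, h⟩ = M.dist M.start (M.goal (σ ⟨0, h⟩)) := by
  have : Finset.Iic (⟨0, h⟩ : Fin n) = {⟨0, h⟩} := by
    ext j
    simp [Fin.le_def, Fin.ext_iff]
  rw [arrival, this, Finset.sum_singleton]
  rfl

theorem arrival_succ {t : ℕ} (h : t + 1 < n) :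
    M.arrival σ ⟨t + 1, h⟩ = M.arrival σ ⟨t, by omega⟩ +
      M.dist (M.goal (σ ⟨t, by omega⟩)) (M.goal (σ ⟨t + 1, h⟩)) := by
  have : Finset.Iic (⟨t + 1, h⟩ : Fin n) =
      insert ⟨t + 1, h⟩ (Finset.Iic (⟨t, by omega⟩ : Fin n)) := by
    ext j
    simp only [Finset.mem_Iic, Finset.mem_insert, Fin.le_def, Fin.ext_iff]
    omega
  rw [arrival, this, Finset.sum_insert (by simp [Fin.le_def]), add_comm]
  rfl

theorem arrival_mono : Monotone (M.arrival σ) := fun _ _ h =>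
  Finset.sum_le_sum_of_subset (Finset.Iic_subset_Iic.2 h)

theorem dist_start_le_arrival (hM : M.HasOptions) (j : Fin n) :
    M.dist M.start (M.goal (σ j)) ≤ M.arrival σ j := by
  obtain ⟨t, ht⟩ := j
  induction t with
  | zero => rw [arrival_zero]
  | succ t ih =>
    rw [arrival_succ]
    exact (dist_triangle (hM.1 _) (hM.2 (σ ⟨t, by omega⟩) _)).trans
      (Nat.add_le_add_right (ih (by omega)) _)

theorem arrival_add_dist_le (hM : M.HasOptions) {j k : Fin n} (hjk : j ≤ k) :
    M.arrival σ j + M.dist (M.goal (σ j)) (M.goal (σ k)) ≤ M.arrival σ k := by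
  obtain ⟨t, ht⟩ := k
  induction t with
  | zero =>
    obtain rfl : j = ⟨0, ht⟩ := le_antisymm hjk (Fin.le_def.2 (Nat.zero_le _))
    simp [dist_self]
  | succ t ih =>
    obtain rfl | hlt := hjk.eq_or_lt
    · simp [dist_self]
    have hprev := ih (by omega) (Fin.le_def.2 (Nat.lt_succ_iff.1 (Fin.lt_def.1 hlt)))
    have htri := dist_triangle (hM.2 (σ j) (σ ⟨t, by omega⟩)) (hM.2 _ (σ ⟨t + 1, ht⟩))
    rw [arrival_succ]
    omega

theorem tourReturn_nonneg (hγ : 0 ≤ γ) : 0 ≤ M.tourReturn γ σ :=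
  Finset.sum_nonneg fun _ _ => pow_nonneg hγ _

theorem opt_nonneg (hγ : 0 ≤ γ) : 0 ≤ M.opt γ :=
  (tourReturn_nonneg 1 hγ).trans
    (Finset.le_sup' (fun σ : Equiv.Perm (Fin n) => M.tourReturn γ σ) (Finset.mem_univ 1))

end Tour

section NN

variable {nn : Equiv.Perm (Fin n)}

theorem IsNNTour.arrival_zero_le (hnn : M.IsNNTour nn) (hM : M.HasOptions) (hn : 0 < n)
    (σ : Equiv.Perm (Fin n)) (j : Fin n) : M.arrival nn ⟨0, hn⟩ ≤ M.arrival σ j := by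
  have hnearest := hnn ⟨0, hn⟩ (nn.symm (σ j)) (Fin.le_def.2 (Nat.zero_le _))
  rw [Equiv.apply_symm_apply] at hnearest
  rw [arrival_zero]
  exact hnearest.trans (dist_start_le_arrival σ hM j)

theorem IsNNTour.pow_arrival_le_tourReturn (hnn : M.IsNNTour nn) (hM : M.HasOptions)
    (hγ : 0 ≤ γ) (hγ1 : γ ≤ 1) (σ : Equiv.Perm (Fin n)) (j : Fin n) :
    γ ^ M.arrival σ j ≤ M.tourReturn γ nn :=
  calc γ ^ M.arrival σ j ≤ γ ^ M.arrival nn ⟨0, j.pos⟩ :=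
        pow_le_pow_of_le_one hγ hγ1 (hnn.arrival_zero_le hM j.pos σ j)
    _ ≤ M.tourReturn γ nn := Finset.single_le_sum (f := fun j => γ ^ M.arrival nn j)
        (fun _ _ => pow_nonneg hγ _) (Finset.mem_univ _)

end NN

section RA

variable {i : Fin n} {τ : Equiv.Perm (Fin n)} {r : ℕ} {T : Finset (Fin n)}

theorem IsRATour.dist_le_of_lt_card (hτ : M.IsRATour i τ)
    (hT : ∀ k ∈ T, M.dist (M.goal i) (M.goal k) ≤ r) {t : Fin n} (ht : t < T.card) :
    M.dist (M.goal i) (M.goal (τ t)) ≤ r := by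
  by_contra! hr
  have hsub : T ⊆ (Finset.Iio t).map τ.toEmbedding := by
    intro k hk
    rw [Finset.mem_map_equiv, Finset.mem_Iio]
    by_contra! hle
    have hdist := hτ.2 hle
    simp only [Equiv.apply_symm_apply] at hdist
    exact (hr.trans_le hdist).not_ge (hT k hk)
  have hcard := Finset.card_le_card hsub
  rw [Finset.card_map, Fin.card_Iio] at hcard
  omega

theorem IsRATour.arrival_le_of_lt_card (hτ : M.IsRATour i τ) (hM : M.HasOptions)
    (hsymm : M.IsUndirected) (hT : ∀ k ∈ T, M.dist (M.goal i) (M.goal k) ≤ r)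
    {t : Fin n} (ht : t < T.card) :
    M.arrival τ t ≤ M.dist M.start (M.goal i) + 2 * r * t := by
  obtain ⟨t, htn⟩ := t
  induction t with
  | zero => simp [arrival_zero, hτ.1 ⟨0, htn⟩ rfl]
  | succ t ih =>
    simp only at ht
    have hprev := ih (by omega) (by simp only; omega)
    have hback := hτ.dist_le_of_lt_card hT (t := ⟨t, by omega⟩) (by simp only; omega)
    have hforth := hτ.dist_le_of_lt_card hT (t := ⟨t + 1, htn⟩) ht
    have htri := dist_triangle (hM.2 (τ ⟨t, by omega⟩) i) (hM.2 i (τ ⟨t + 1, htn⟩))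
    rw [hsymm _ i] at htri
    rw [arrival_succ]
    simp only [mul_add, mul_one] at hprev ⊢
    omega

theorem IsRATour.card_mul_pow_le_tourReturn (hτ : M.IsRATour i τ) (hM : M.HasOptions)
    (hsymm : M.IsUndirected) (hγ : 0 ≤ γ) (hγ1 : γ ≤ 1)
    (hT : ∀ k ∈ T, M.dist (M.goal i) (M.goal k) ≤ r) :
    T.card * γ ^ (M.dist M.start (M.goal i) + 2 * r * (T.card - 1)) ≤ M.tourReturn γ τ := by
  set s : Finset (Fin n) := {t | (t : ℕ) < T.card} with hs
  have hs_card : s.card = T.card := by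
    rw [hs, Fin.card_filter_val_lt]
    exact min_eq_right (by simpa using T.card_le_univ)
  calc T.card * γ ^ (M.dist M.start (M.goal i) + 2 * r * (T.card - 1))
      = ∑ _t ∈ s, γ ^ (M.dist M.start (M.goal i) + 2 * r * (T.card - 1)) := by
        rw [Finset.sum_const, hs_card, nsmul_eq_mul]
    _ ≤ ∑ t ∈ s, γ ^ M.arrival τ t := by
        refine Finset.sum_le_sum fun t ht => pow_le_pow_of_le_one hγ hγ1 ?_
        have ht : t < T.card := (Finset.mem_filter.1 ht).2
        refine (hτ.arrival_le_of_lt_card hM hsymm hT ht).trans ?_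
        gcongr
        omega
    _ ≤ M.tourReturn γ τ := Finset.sum_le_univ_sum_of_nonneg fun _ => pow_nonneg hγ _

theorem IsRATour.mul_pow_le_tourReturn_of_eq_add (σ : Equiv.Perm (Fin n)) {j l : Fin n} {q : ℕ}
    (hτ : M.IsRATour (σ j) τ) (hM : M.HasOptions) (hsymm : M.IsUndirected) (hγ : 0 ≤ γ)
    (hγ1 : γ ≤ 1) (hl : (l : ℕ) = j + q) :
    (q + 1) * γ ^ (M.arrival σ j + 2 * (M.arrival σ l - M.arrival σ j) * q) ≤
      M.tourReturn γ τ := by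
  set T := (Finset.Icc j l).map σ.toEmbedding with hT_def
  have hT_card : T.card = q + 1 := by
    rw [hT_def, Finset.card_map, Fin.card_Icc]
    omega
  have hT : ∀ k ∈ T,
      M.dist (M.goal (σ j)) (M.goal k) ≤ M.arrival σ l - M.arrival σ j := by
    intro k hk
    obtain ⟨t, ht, rfl⟩ := Finset.mem_map.1 hk
    obtain ⟨hjt, htl⟩ := Finset.mem_Icc.1 ht
    have hdist := arrival_add_dist_le σ hM hjt
    have hmono := arrival_mono (M := M) σ htl
    simp only [Equiv.coe_toEmbedding]
    omega
  have hcollect := hτ.card_mul_pow_le_tourReturn hM hsymm hγ hγ1 hT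
  rw [hT_card, Nat.add_sub_cancel] at hcollect
  push_cast at hcollect
  refine le_trans ?_ hcollect
  refine mul_le_mul_of_nonneg_left (pow_le_pow_of_le_one hγ hγ1 ?_) (by positivity)
  exact Nat.add_le_add_right (dist_start_le_arrival σ hM j) _

variable {ra : Fin n → Equiv.Perm (Fin n)}

theorem mul_pow_le_sum_tourReturn_of_stretch (hM : M.HasOptions) (hsymm : M.IsUndirected)
    (hγ : 0 ≤ γ) (hγ1 : γ ≤ 1) (hra : ∀ i, M.IsRATour i (ra i)) (σ : Equiv.Perm (Fin n))
    {h m : Fin n} {k q W : ℕ} (hk : 0 < k) (hm : (h : ℕ) + k + q = m + 1) (hq : q ^ 2 ≤ k)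
    (hW : M.arrival σ m = M.arrival σ h + W) :
    k * (q + 1) * γ ^ (M.arrival σ h + 3 * W) ≤ ∑ i, M.tourReturn γ (ra i) := by
  -- Truncating at `m` makes the arrival times a monotone function on all of `ℕ`.
  let c (t : ℕ) : Fin n := ⟨min (h + t) m, (min_le_right _ _).trans_lt m.isLt⟩
  let a (t : ℕ) : ℕ := M.arrival σ (c t)
  have hc_val {t : ℕ} (ht : t < k + q) : (c t : ℕ) = h + t := min_eq_left (by omega)
  have ha : Monotone a := (arrival_mono σ).comp fun s t hst =>
    Fin.le_def.2 (min_le_min_right _ (by omega))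
  have ha0 : a 0 = M.arrival σ h :=
    congrArg (M.arrival σ) (Fin.ext (hc_val (t := 0) (by omega)))
  have haW (t : ℕ) : a t ≤ a 0 + W := by
    rw [ha0, ← hW]
    exact arrival_mono σ (Fin.le_def.2 (min_le_right _ _))
  have hinj : Set.InjOn c (Finset.range k) := fun s hs t ht hst => by
    have hs : s < k := Finset.mem_range.1 hs
    have ht : t < k := Finset.mem_range.1 ht
    have hval := congrArg Fin.val hst
    rw [hc_val (by omega), hc_val (by omega)] at hval
    omega
  calc k * (q + 1) * γ ^ (M.arrival σ h + 3 * W)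
      = (q + 1) * ((Finset.range k).card * γ ^ (a 0 + 3 * W)) := by
        rw [Finset.card_range, ha0]
        ring
    _ ≤ (q + 1) * ∑ t ∈ Finset.range k, γ ^ (a t + 2 * (a (t + q) - a t) * q) := by
        gcongr
        refine card_mul_pow_le_sum_pow hγ hγ1 ?_
        rw [Finset.card_range]
        exact sum_range_add_mul_sub_shift_le ha hq haW
    _ ≤ ∑ t ∈ Finset.range k, M.tourReturn γ (ra (σ (c t))) := by
        rw [Finset.mul_sum]
        refine Finset.sum_le_sum fun t ht => ?_
        have ht : t < k := Finset.mem_range.1 ht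
        refine (hra (σ (c t))).mul_pow_le_tourReturn_of_eq_add σ hM hsymm hγ hγ1 ?_
        rw [hc_val (by omega), hc_val (by omega), add_assoc]
    _ ≤ ∑ j, M.tourReturn γ (ra (σ j)) :=
        sum_comp_le_sum_of_injOn (f := fun j => M.tourReturn γ (ra (σ j))) hinj
          fun _ => tourReturn_nonneg _ hγ
    _ = ∑ i, M.tourReturn γ (ra i) := Equiv.sum_comp σ fun i => M.tourReturn γ (ra i)

theorem mul_sqrt_mul_pow_arrival_le_of_isMax (hM : M.HasOptions) (hsymm : M.IsUndirected)
    (hγ : 0 ≤ γ) (hγ1 : γ ≤ 1) (hra : ∀ i, M.IsRATour i (ra i)) (σ : Equiv.Perm (Fin n))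
    {m : Fin n} (hmax : ∀ j : Fin n, ((j : ℝ) + 1) * √(j + 1) * γ ^ M.arrival σ j ≤
      ((m : ℝ) + 1) * √(m + 1) * γ ^ M.arrival σ m) :
    ((m : ℝ) + 1) * √(m + 1) * γ ^ M.arrival σ m ≤ 64 * ∑ i, M.tourReturn γ (ra i) := by
  obtain ⟨h, k, q, hm, hk, hqk, hkq, hmk, hmh⟩ := exists_add_add_eq_succ_and_sq_le m
  lift h to Fin n using by omega
  obtain ⟨W, hW⟩ := Nat.exists_eq_add_of_le
    (arrival_mono (M := M) σ (Fin.le_def.2 (by omega) : h ≤ m))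
  have hmh : (m : ℝ) + 1 ≤ 2 * ((h : ℝ) + 1) := by exact_mod_cast hmh
  have hmk : (m : ℝ) + 1 ≤ 4 * k := by exact_mod_cast hmk
  have hkq : (k : ℝ) ≤ (q + 1) ^ 2 := by exact_mod_cast hkq
  have hsq : (γ ^ M.arrival σ h) ^ 2 ≤ 8 * (γ ^ (M.arrival σ h + W)) ^ 2 := by
    have hmax_sq := pow_le_pow_left₀ (by positivity) (hmax h) 2
    simp only [mul_pow, Real.sq_sqrt (by positivity : (0 : ℝ) ≤ (h : ℝ) + 1),
      Real.sq_sqrt (by positivity : (0 : ℝ) ≤ (m : ℝ) + 1), ← pow_succ] at hmax_sq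
    rw [← hW]
    refine le_of_mul_le_mul_left ?_ (by positivity : 0 < ((h : ℝ) + 1) ^ 3)
    calc ((h : ℝ) + 1) ^ 3 * (γ ^ M.arrival σ h) ^ 2
        ≤ ((m : ℝ) + 1) ^ 3 * (γ ^ M.arrival σ m) ^ 2 := hmax_sq
      _ ≤ (2 * ((h : ℝ) + 1)) ^ 3 * (γ ^ M.arrival σ m) ^ 2 := by gcongr
      _ = ((h : ℝ) + 1) ^ 3 * (8 * (γ ^ M.arrival σ m) ^ 2) := by ring
  have hsqrt : √((m : ℝ) + 1) ≤ 2 * (q + 1) :=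
    Real.sqrt_le_iff.2 ⟨by positivity, by linarith⟩
  calc ((m : ℝ) + 1) * √(m + 1) * γ ^ M.arrival σ m
      ≤ 4 * k * (2 * (q + 1)) * (8 * γ ^ (M.arrival σ h + 3 * W)) := by
        gcongr
        rw [hW]
        exact pow_add_le_mul_pow_add_of_sq_le hγ hsq
    _ = 64 * (k * (q + 1) * γ ^ (M.arrival σ h + 3 * W)) := by ring
    _ ≤ 64 * ∑ i, M.tourReturn γ (ra i) := by
        gcongr
        exact mul_pow_le_sum_tourReturn_of_stretch hM hsymm hγ hγ1 hra σ hk hm hqk hW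

theorem mul_sqrt_mul_pow_arrival_le (hM : M.HasOptions) (hsymm : M.IsUndirected) (hγ : 0 ≤ γ)
    (hγ1 : γ ≤ 1) (hra : ∀ i, M.IsRATour i (ra i)) (σ : Equiv.Perm (Fin n)) (j : Fin n) :
    ((j : ℝ) + 1) * √(j + 1) * γ ^ M.arrival σ j ≤ 64 * ∑ i, M.tourReturn γ (ra i) := by
  have : Nonempty (Fin n) := ⟨j⟩
  obtain ⟨m, hmax⟩ := Finite.exists_max
    fun j : Fin n => ((j : ℝ) + 1) * √(j + 1) * γ ^ M.arrival σ j
  exact (hmax j).trans (mul_sqrt_mul_pow_arrival_le_of_isMax hM hsymm hγ hγ1 hra σ hmax)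

end RA

section Mixture

variable {nn : Equiv.Perm (Fin n)} {ra : Fin n → Equiv.Perm (Fin n)}

theorem tourReturn_le_mul_nnraReturn (hM : M.HasOptions) (hsymm : M.IsUndirected) (hγ : 0 ≤ γ)
    (hγ1 : γ ≤ 1) (hnn : M.IsNNTour nn) (hra : ∀ i, M.IsRATour i (ra i))
    (σ : Equiv.Perm (Fin n)) :
    M.tourReturn γ σ ≤ 256 * (n : ℝ) ^ (2 / 3 : ℝ) * M.nnraReturn γ nn ra := by
  have hN : 0 ≤ M.tourReturn γ nn := tourReturn_nonneg nn hγ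
  have hR : 0 ≤ ∑ i, M.tourReturn γ (ra i) :=
    Finset.sum_nonneg fun i _ => tourReturn_nonneg (ra i) hγ
  set R := ∑ i, M.tourReturn γ (ra i)
  calc M.tourReturn γ σ = ∑ j, γ ^ M.arrival σ j := rfl
    _ ≤ 2 * (n : ℝ) ^ (2 / 3 : ℝ) * (M.tourReturn γ nn + 64 * R / n) :=
        sum_le_rpow_two_thirds_mul hN (mul_nonneg (by norm_num) hR)
          (hnn.pow_arrival_le_tourReturn hM hγ hγ1 σ)
          (mul_sqrt_mul_pow_arrival_le hM hsymm hγ hγ1 hra σ)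
    _ ≤ 2 * (n : ℝ) ^ (2 / 3 : ℝ) * (64 * M.tourReturn γ nn + 64 * R / n) := by
        gcongr
        linarith
    _ = 256 * (n : ℝ) ^ (2 / 3 : ℝ) * M.nnraReturn γ nn ra := by
        rw [nnraReturn, ← Finset.mul_sum]
        ring

end Mixture

end CollectibleMDP

theorem mainTheorem5_general {n : ℕ} {M : CollectibleMDP n} {γ : ℝ} {nn : Equiv.Perm (Fin n)}
    {ra : Fin n → Equiv.Perm (Fin n)} (hγ : 0 ≤ γ) (hγ1 : γ ≤ 1) (hM : M.HasOptions)
    (hsymm : M.IsUndirected) (hnn : M.IsNNTour nn) (hra : ∀ i, M.IsRATour i (ra i)) :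
    M.opt γ ≤ 256 * (n : ℝ) ^ (2 / 3 : ℝ) * M.nnraReturn γ nn ra :=
  Finset.sup'_le _ _ fun σ _ =>
    CollectibleMDP.tourReturn_le_mul_nnraReturn hM hsymm hγ hγ1 hnn hra σ

theorem CollectibleMDP.mul_rpow_neg_div_log_le_nnraReturn {n : ℕ} {M : CollectibleMDP n} {γ β : ℝ}
    {nn : Equiv.Perm (Fin n)} {ra : Fin n → Equiv.Perm (Fin n)} (hβ : 2 / 3 ≤ β) (hn : 2 ≤ n)
    (hγ : 0 ≤ γ) (hγ1 : γ ≤ 1) (hM : M.HasOptions) (hsymm : M.IsUndirected)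
    (hnn : M.IsNNTour nn) (hra : ∀ i, M.IsRATour i (ra i)) :
    1 / 512 * (M.opt γ * (n : ℝ) ^ (-β) / Real.log n) ≤ M.nnraReturn γ nn ra := by
  have hn1 : (1 : ℝ) ≤ n := by exact_mod_cast (by omega : 1 ≤ n)
  have hopt : 0 ≤ M.opt γ := opt_nonneg hγ
  have hlog : 1 / 2 ≤ Real.log n :=
    calc (1 / 2 : ℝ) ≤ Real.log 2 := by linarith [Real.log_two_gt_d9]
      _ ≤ Real.log n := Real.log_le_log two_pos (by exact_mod_cast hn)
  have hpow : (n : ℝ) ^ (-β) ≤ (n : ℝ) ^ (-(2 / 3) : ℝ) :=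
    Real.rpow_le_rpow_of_exponent_le hn1 (by linarith)
  have hcancel : (n : ℝ) ^ (2 / 3 : ℝ) * (n : ℝ) ^ (-(2 / 3) : ℝ) = 1 := by
    rw [← Real.rpow_add (by linarith), add_neg_cancel, Real.rpow_zero]
  calc 1 / 512 * (M.opt γ * (n : ℝ) ^ (-β) / Real.log n)
      ≤ 1 / 512 * (M.opt γ * (n : ℝ) ^ (-(2 / 3) : ℝ) / (1 / 2)) := by gcongr
    _ = 1 / 256 * M.opt γ * (n : ℝ) ^ (-(2 / 3) : ℝ) := by ring
    _ ≤ 1 / 256 * (256 * (n : ℝ) ^ (2 / 3 : ℝ) * M.nnraReturn γ nn ra) *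
          (n : ℝ) ^ (-(2 / 3) : ℝ) := by
        gcongr
        exact mainTheorem5_general hγ hγ1 hM hsymm hnn hra
    _ = M.nnraReturn γ nn ra := by linear_combination M.nnraReturn γ nn ra * hcancel

theorem mainTheorem5 :
    (∀ α : ℝ, 0 < α → ∃ c : ℝ, 0 < c ∧
      ∀ (n : ℕ) (M : CollectibleMDP n) (γ : ℝ) (nn : Equiv.Perm (Fin n))
        (ra : Fin n → Equiv.Perm (Fin n)),
        2 ≤ n → 0 ≤ γ → γ ≤ 1 → M.HasOptions → M.IsUndirected →
        M.IsNNTour nn → (∀ i, M.IsRATour i (ra i)) →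
        α * (n : ℝ) ≤ M.opt γ →
        c * (M.opt γ * (n : ℝ) ^ (-(2 / 3) : ℝ) / Real.log n) ≤ M.nnraReturn γ nn ra) ∧
    (∃ c : ℝ, 0 < c ∧
      ∀ (n : ℕ) (M : CollectibleMDP n) (γ : ℝ) (nn : Equiv.Perm (Fin n))
        (ra : Fin n → Equiv.Perm (Fin n)),
        2 ≤ n → 0 ≤ γ → γ ≤ 1 → M.HasOptions → M.IsUndirected →
        M.IsNNTour nn → (∀ i, M.IsRATour i (ra i)) →
        c * (M.opt γ * (n : ℝ) ^ (-(3 / 4) : ℝ) / Real.log n) ≤ M.nnraReturn γ nn ra) :=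
  open CollectibleMDP in
  ⟨fun _ _ => ⟨1 / 512, by norm_num, fun _ _ _ _ _ hn hγ hγ1 hM hsymm hnn hra _ =>
      mul_rpow_neg_div_log_le_nnraReturn le_rfl hn hγ hγ1 hM hsymm hnn hra⟩,
    1 / 512, by norm_num, fun _ _ _ _ _ hn hγ hγ1 hM hsymm hnn hra =>
      mul_rpow_neg_div_log_le_nnraReturn (by norm_num) hn hγ hγ1 hM hsymm hnn hra⟩
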